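/- Consider $n$ items with real scores $\mu_1\ge\dots\ge\mu_k>\mu_{k+1}\ge\dots\ge\mu_n$, where $1\le k<n$, and put $\theta_i=e^{\mu_i}$. Item $i$ is presented under the label $\pi_i$, where $\pi$ is a uniformly random permutation of $\{1,\dots,n\}$ that is unknown to the algorithm. Let $l\ge 2$. A (possibly randomized and adaptive) algorithm repeatedly chooses, on the basis of the previous answers, a set $S$ of labels with $2\le |S|\le l$, and is told one label of $S$, drawn afresh from the multinomial logit model: the label of an item $a$ whose label lies in $S$ is reported with probability $\theta_a/\sum_{j:\pi_j\in S}\theta_j$. At the end it outputs a set of labels; it identifies the top-$k$ items if this set is $\{\pi_1,\dots,\pi_k\}$. The algorithm may depend on $n,k,l$ and on all the values $\theta_1\ge\dots\ge\theta_n$, but it does not know which label carries which value. There is a universal constant $c>0$ such that, for all such $n,k,l,\mu_1,\dots,\mu_n$, every algorithm that always uses at most $T$ comparisons and identifies the top-$k$ items with probability at least $7/8$ (over $\pi$, the answers and its own randomness) satisfies $$T\;\ge\; c\Biggl(\frac{n}{l}+k+\frac{\sum_{i\ge k+1}\theta_i}{\theta_k}+\sum_{i\ge k+1,\ \theta_i\ge\theta_k/2}\frac{\theta_k^2}{(\theta_k-\theta_i)^2}+\sum_{i\le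 k,\ \theta_i\le 2\theta_{k+1}}\frac{\theta_{k+1}^2}{(\theta_{k+1}-\theta_i)^2}\Biggr).$$ -/

import Mathlib

open scoped ENNReal

namespace TopK

/-- The multinomial logit choice law: from the nonempty set `S` of labels, where label `j` carries
the score `μ j`, the label `a ∈ S` is reported with probability `exp (μ a) / ∑ j ∈ S, exp (μ j)`. -/
noncomputable def mnlChoice {n : ℕ} (μ : Fin n → ℝ) (S : Finset (Fin n)) (hS : S.Nonempty) :
    PMF S :=
  PMF.ofFintype
    (fun a : S => ENNReal.ofReal (Real.exp (μ a) / ∑ j ∈ S, Real.exp (μ j)))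
    (by
      have hpos : 0 < ∑ j ∈ S, Real.exp (μ j) := Finset.sum_pos (fun j _ => Real.exp_pos _) hS
      rw [← ENNReal.ofReal_sum_of_nonneg
        (fun a _ => div_nonneg (Real.exp_pos _).le hpos.le), ← Finset.sum_div,
        Finset.sum_coe_sort S (fun j => Real.exp (μ j)), div_self hpos.ne', ENNReal.ofReal_one])

/-- A deterministic adaptive algorithm on `n` labelled items using comparisons of size at most `l`,
as a decision tree: it either stops and outputs a set of labels, or it compares a set `S` of labels
with `2 ≤ |S| ≤ l` and continues in a way that depends on the reported label. -/
inductive DetAlgorithm (n l : ℕ) : Type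
  | output (R : Finset (Fin n)) : DetAlgorithm n l
  | compare (S : Finset (Fin n)) (two_le : 2 ≤ S.card) (le_l : S.card ≤ l)
      (next : S → DetAlgorithm n l) : DetAlgorithm n l

/-- The number of comparisons of a deterministic algorithm in the worst case. -/
def DetAlgorithm.comparisons {n l : ℕ} : DetAlgorithm n l → ℕ
  | .output _ => 0
  | .compare _ _ _ next => 1 + Finset.univ.sup (fun a => (next a).comparisons)

/-- The law of the output of a deterministic algorithm when the item labelled `j` has score `μ j`;
all answers are drawn afresh from the multinomial logit model. -/
noncomputable def DetAlgorithm.outputLaw {n l : ℕ} (μ : Fin n → ℝ) :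
    DetAlgorithm n l → PMF (Finset (Fin n))
  | .output R => PMF.pure R
  | .compare S two_le _ next =>
      (mnlChoice μ S (Finset.card_pos.mp (lt_of_lt_of_le two_pos two_le))).bind
        (fun a => (next a).outputLaw μ)

/-- A (possibly randomized) adaptive algorithm: its internal random string selects a deterministic
one. Decision trees have finite depth and branching, so there are countably many of them and every
probability distribution on them is of this form. -/
abbrev Algorithm (n l : ℕ) : Type := PMF (DetAlgorithm n l)

/-- The algorithm never makes more than `T` comparisons. -/
def Algorithm.UsesAtMost {n l : ℕ} (A : Algorithm n l) (T : ℕ) : Prop :=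
  ∀ t ∈ A.support, t.comparisons ≤ T

/-- The labels of the first `k` items, when item `i` has the label `π i`. -/
def topLabels {n : ℕ} (k : ℕ) (π : Equiv.Perm (Fin n)) : Finset (Fin n) :=
  (Finset.univ.filter (fun i : Fin n => i.val < k)).image π

/-- The joint law of the labelling `π`, a uniform permutation, and of the output of the algorithm
`A`, when item `i` has score `μ i` and label `π i` (so that label `j` has score `μ (π⁻¹ j)`). -/
noncomputable def jointLaw {n l : ℕ} (A : Algorithm n l) (μ : Fin n → ℝ) :
    PMF (Equiv.Perm (Fin n) × Finset (Fin n)) :=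
  (PMF.uniformOfFintype (Equiv.Perm (Fin n))).bind fun π =>
    A.bind fun t => (t.outputLaw (fun j => μ (π.symm j))).map fun R => (π, R)

/-- The probability that the algorithm outputs exactly the labels of the first `k` items. -/
noncomputable def successProb {n l : ℕ} (A : Algorithm n l) (μ : Fin n → ℝ) (k : ℕ) : ℝ≥0∞ :=
  (jointLaw A μ).toOuterMeasure {x | x.2 = topLabels k x.1}

end TopK

/-! Fix a deterministic algorithm that succeeds with probability at least 7/8 over the labellings.
For an item `i`, give its label the score of an item `j` on the other side of the boundary. Then
exchanging the labels of `i` and `j` changes nothing observable but changes the correct answer, so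
the average success drops to at most 1/2 (`sum_outputProb_levelledScore_le`). Hence changing one
score must noticeably affect the output, and this forces a cost chargeable to `i` alone.

Three charges are used: comparisons containing `i`; reports of `i`, when its score is lowered; and,
for any change `d` of the score, `exp d - 1 - d` times the expected number of reports of `i`, via
relative entropy (`exp_outputProb_sub_reportCost_le`). A comparison has one report and at most `l`
participants, so summing over `i` bounds the reports by `T` and the participations by `l * T`.
Taking for `j` the last top item or the first lower item gives each of the five terms separately. -/

namespace TopK

/-! ### Choice probabilities -/

/-- The multinomial logit probability that `a` is reported from `S`. -/
noncomputable def choiceProb {n : ℕ} (μ : Fin n → ℝ) (S : Finset (Fin n)) (a : Fin n) : ℝ :=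
  Real.exp (μ a) / ∑ j ∈ S, Real.exp (μ j)

lemma sum_exp_pos {n : ℕ} (μ : Fin n → ℝ) {S : Finset (Fin n)} (hS : S.Nonempty) :
    0 < ∑ j ∈ S, Real.exp (μ j) :=
  Finset.sum_pos (fun _ _ => Real.exp_pos _) hS

lemma choiceProb_pos {n : ℕ} (μ : Fin n → ℝ) {S : Finset (Fin n)} (hS : S.Nonempty) (a : Fin n) :
    0 < choiceProb μ S a :=
  div_pos (Real.exp_pos _) (sum_exp_pos μ hS)

lemma choiceProb_nonneg {n : ℕ} (μ : Fin n → ℝ) (S : Finset (Fin n)) (a : Fin n) :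
    0 ≤ choiceProb μ S a :=
  div_nonneg (Real.exp_pos _).le (Finset.sum_nonneg fun _ _ => (Real.exp_pos _).le)

lemma sum_choiceProb {n : ℕ} (μ : Fin n → ℝ) {S : Finset (Fin n)} (hS : S.Nonempty) :
    ∑ a : S, choiceProb μ S a = 1 := by
  unfold choiceProb
  rw [← Finset.sum_div, Finset.sum_coe_sort S (fun j => Real.exp (μ j)),
    div_self (sum_exp_pos μ hS).ne']

namespace DetAlgorithm

variable {n l : ℕ}

lemma nonempty_of_two_le {S : Finset (Fin n)} (h : 2 ≤ S.card) : S.Nonempty :=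
  Finset.card_pos.mp (lt_of_lt_of_le two_pos h)

/-! ### Output probabilities and additive costs of decision trees -/

/-- The probability that the algorithm outputs the set `R`. -/
noncomputable def outputProb (μ : Fin n → ℝ) (R : Finset (Fin n)) (t : DetAlgorithm n l) : ℝ :=
  (t.outputLaw μ R).toReal

/-- The expected total cost, when the answer `a` to the comparison of `S` costs `c S a`. -/
noncomputable def expectedCost (μ : Fin n → ℝ) (c : Finset (Fin n) → Fin n → ℝ) :
    DetAlgorithm n l → ℝ
  | .output _ => 0
  | .compare S _ _ next =>
      ∑ a : S, choiceProb μ S a * (c S a + (next a).expectedCost μ c)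

lemma outputProb_compare (μ : Fin n → ℝ) (R S : Finset (Fin n)) (h₁ : 2 ≤ S.card)
    (h₂ : S.card ≤ l) (next : S → DetAlgorithm n l) :
    (compare S h₁ h₂ next).outputProb μ R =
      ∑ a : S, choiceProb μ S a * (next a).outputProb μ R := by
  unfold outputProb
  rw [outputLaw, PMF.bind_apply, tsum_fintype, ENNReal.toReal_sum
    (fun a _ => ENNReal.mul_ne_top (PMF.apply_ne_top _ _) (PMF.apply_ne_top _ _))]
  refine Finset.sum_congr rfl fun a _ => ?_
  rw [ENNReal.toReal_mul, mnlChoice, PMF.ofFintype_apply]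
  exact congrArg (· * (next a).outputProb μ R) (ENNReal.toReal_ofReal (choiceProb_nonneg μ S a))

lemma outputProb_nonneg (μ : Fin n → ℝ) (R : Finset (Fin n)) (t : DetAlgorithm n l) :
    0 ≤ t.outputProb μ R :=
  ENNReal.toReal_nonneg

lemma outputProb_add_le_one (μ : Fin n → ℝ) {R R' : Finset (Fin n)} (h : R ≠ R')
    (t : DetAlgorithm n l) : t.outputProb μ R + t.outputProb μ R' ≤ 1 := by
  unfold outputProb
  rw [← ENNReal.toReal_add (PMF.apply_ne_top _ _) (PMF.apply_ne_top _ _),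
    ← Finset.sum_pair (f := fun x => t.outputLaw μ x) h]
  refine ENNReal.toReal_le_of_le_ofReal zero_le_one ?_
  rw [ENNReal.ofReal_one, ← (t.outputLaw μ).tsum_coe]
  exact ENNReal.sum_le_tsum _

lemma outputProb_le_one (μ : Fin n → ℝ) (R : Finset (Fin n)) (t : DetAlgorithm n l) :
    t.outputProb μ R ≤ 1 :=
  ENNReal.toReal_le_of_le_ofReal zero_le_one (by simpa using PMF.coe_le_one _ _)

lemma expectedCost_nonneg (μ : Fin n → ℝ) {c : Finset (Fin n) → Fin n → ℝ}
    (hc : ∀ S a, 0 ≤ c S a) (t : DetAlgorithm n l) : 0 ≤ t.expectedCost μ c := by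
  induction t with
  | output R => exact le_rfl
  | compare S h₁ h₂ next ih =>
    exact Finset.sum_nonneg fun a _ =>
      mul_nonneg (choiceProb_nonneg _ _ _) (add_nonneg (hc _ _) (ih a))

lemma expectedCost_sum {ι : Type*} (s : Finset ι) (μ : Fin n → ℝ)
    (c : ι → Finset (Fin n) → Fin n → ℝ) (t : DetAlgorithm n l) :
    ∑ i ∈ s, t.expectedCost μ (c i) = t.expectedCost μ (fun S a => ∑ i ∈ s, c i S a) := by
  induction t with
  | output R => simp [expectedCost]
  | compare S h₁ h₂ next ih =>
    simp only [expectedCost]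
    rw [Finset.sum_comm]
    refine Finset.sum_congr rfl fun a _ => ?_
    rw [← Finset.mul_sum, Finset.sum_add_distrib, ih a]

lemma expectedCost_le (μ : Fin n → ℝ) {c : Finset (Fin n) → Fin n → ℝ} {B : ℝ} (hB : 0 ≤ B)
    (hc : ∀ S a, S.card ≤ l → c S a ≤ B) (t : DetAlgorithm n l) :
    t.expectedCost μ c ≤ B * t.comparisons := by
  induction t with
  | output R => simp [expectedCost, comparisons]
  | compare S h₁ h₂ next ih =>
    simp only [expectedCost, comparisons]
    rw [← one_mul (B * _), ← sum_choiceProb μ (nonempty_of_two_le h₁), Finset.sum_mul]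
    refine Finset.sum_le_sum fun a _ => mul_le_mul_of_nonneg_left ?_ (choiceProb_nonneg _ _ _)
    have h : (next a).comparisons ≤ Finset.univ.sup fun a => (next a).comparisons :=
      Finset.le_sup (f := fun a => (next a).comparisons) (Finset.mem_univ a)
    have h' : ((next a).comparisons : ℝ) ≤
        ((Finset.univ.sup fun a => (next a).comparisons : ℕ) : ℝ) := Nat.cast_le.mpr h
    have := mul_le_mul_of_nonneg_left h' hB
    have := ih a
    have := hc S a h₂
    push_cast [Nat.cast_add]
    linarith

/-- Counts the comparisons in which the label `x` takes part. -/
def touchCost (x : Fin n) (S : Finset (Fin n)) (_a : Fin n) : ℝ := if x ∈ S then 1 else 0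

/-- Counts the comparisons in which the label `x` is reported. -/
def reportCost (x : Fin n) (_S : Finset (Fin n)) (a : Fin n) : ℝ := if x = a then 1 else 0

lemma touchCost_nonneg (x : Fin n) (S : Finset (Fin n)) (a : Fin n) : 0 ≤ touchCost x S a := by
  unfold touchCost; split_ifs <;> norm_num

lemma reportCost_nonneg (x : Fin n) (S : Finset (Fin n)) (a : Fin n) : 0 ≤ reportCost x S a := by
  unfold reportCost; split_ifs <;> norm_num

lemma sum_touchCost_le (e : Equiv.Perm (Fin n)) {μ : Fin n → ℝ} (t : DetAlgorithm n l) :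
    ∑ i, t.expectedCost μ (touchCost (e i)) ≤ l * t.comparisons := by
  rw [expectedCost_sum]
  refine expectedCost_le μ (Nat.cast_nonneg l) (fun S a hS => ?_) t
  rw [Equiv.sum_comp e (fun x => touchCost x S a)]
  simpa [touchCost] using hS

lemma sum_reportCost_le (e : Equiv.Perm (Fin n)) {μ : Fin n → ℝ} (t : DetAlgorithm n l) :
    ∑ i, t.expectedCost μ (reportCost (e i)) ≤ t.comparisons := by
  rw [expectedCost_sum, ← one_mul (t.comparisons : ℝ)]
  refine expectedCost_le μ zero_le_one (fun S a _ => ?_) t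
  rw [Equiv.sum_comp e (fun x => reportCost x S a)]
  simp [reportCost]

/-- Under the two score vectors, runs have the same law until `x` is first compared, and the
probability of that event is at most the expected number of such comparisons. -/
lemma outputProb_sub_touchCost_le {μ μ' : Fin n → ℝ} {x : Fin n} (h : ∀ y, y ≠ x → μ' y = μ y)
    (R : Finset (Fin n)) (t : DetAlgorithm n l) :
    t.outputProb μ R - t.expectedCost μ (touchCost x) ≤ t.outputProb μ' R := by
  induction t with
  | output R' => simp [expectedCost, outputProb, outputLaw]
  | compare S h₁ h₂ next ih =>
    rw [outputProb_compare, outputProb_compare, expectedCost, ← Finset.sum_sub_distrib]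
    refine Finset.sum_le_sum fun a _ => ?_
    rw [← mul_sub]
    by_cases hx : x ∈ S
    -- The current comparison already costs 1, so the left side is nonpositive.
    · refine le_trans (mul_nonpos_of_nonneg_of_nonpos (choiceProb_nonneg _ _ _) ?_)
        (mul_nonneg (choiceProb_nonneg _ _ _) (outputProb_nonneg _ _ _))
      have := outputProb_le_one μ R (next a)
      have := expectedCost_nonneg μ (touchCost_nonneg x) (next a)
      simp only [touchCost, if_pos hx] at *
      linarith
    · have hne : ∀ y ∈ S, y ≠ x := fun y hy hyx => hx (hyx ▸ hy)
      have hp : choiceProb μ' S a = choiceProb μ S a := by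
        unfold choiceProb
        rw [h a (hne a a.2), Finset.sum_congr rfl fun j hj => by rw [h j (hne j hj)]]
      rw [hp]
      refine mul_le_mul_of_nonneg_left ?_ (choiceProb_nonneg _ _ _)
      have := ih a
      have h0 : touchCost x S a = 0 := if_neg hx
      rw [h0]
      linarith

/-- Lowering the score of `x` makes every other answer at least as likely, so a run that never
reports `x` does not lose probability; only runs reporting `x` can be lost. -/
lemma outputProb_sub_reportCost_le {μ μ' : Fin n → ℝ} {x : Fin n} (h : ∀ y, y ≠ x → μ' y = μ y)
    (hx : μ' x ≤ μ x) (R : Finset (Fin n)) (t : DetAlgorithm n l) :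
    t.outputProb μ R - t.expectedCost μ (reportCost x) ≤ t.outputProb μ' R := by
  induction t with
  | output R' => simp [expectedCost, outputProb, outputLaw]
  | compare S h₁ h₂ next ih =>
    rw [outputProb_compare, outputProb_compare, expectedCost, ← Finset.sum_sub_distrib]
    refine Finset.sum_le_sum fun a _ => ?_
    rw [← mul_sub]
    by_cases hax : x = a
    · refine le_trans (mul_nonpos_of_nonneg_of_nonpos (choiceProb_nonneg _ _ _) ?_)
        (mul_nonneg (choiceProb_nonneg _ _ _) (outputProb_nonneg _ _ _))
      have := outputProb_le_one μ R (next a)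
      have := expectedCost_nonneg μ (reportCost_nonneg x) (next a)
      have h1 : reportCost x S a = 1 := if_pos hax
      rw [h1]
      linarith
    · have h0 : reportCost x S a = 0 := if_neg hax
      have hle : ∀ y, μ' y ≤ μ y := fun y => by
        by_cases hy : y = x
        · rwa [hy]
        · exact (h y hy).le
      have hp : choiceProb μ S a ≤ choiceProb μ' S a := by
        unfold choiceProb
        rw [h a (Ne.symm hax)]
        exact div_le_div_of_nonneg_left (Real.exp_pos _).le
          (sum_exp_pos μ' (nonempty_of_two_le h₁))
          (Finset.sum_le_sum fun j _ => Real.exp_le_exp.mpr (hle j))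
      refine le_trans (mul_le_mul_of_nonneg_left (?_ : _ ≤ (next a).outputProb μ' R)
        (choiceProb_nonneg _ _ _)) (mul_le_mul_of_nonneg_right hp (outputProb_nonneg _ _ _))
      have := ih a
      rw [h0]
      linarith

/-- The relative entropy of a single answer when the score of `x` changes, in terms of the
probability that `x` is reported. -/
lemma neg_sum_le_sum_choiceProb_mul_log {μ μ' : Fin n → ℝ} {x : Fin n}
    (h : ∀ y, y ≠ x → μ' y = μ y) {S : Finset (Fin n)} (hS : S.Nonempty) :
    -((Real.exp (μ' x - μ x) - 1 - (μ' x - μ x)) * ∑ a : S, choiceProb μ S a * reportCost x S a) ≤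
      ∑ a : S, choiceProb μ S a * Real.log (choiceProb μ' S a / choiceProb μ S a) := by
  set d := μ' x - μ x with hd
  set W := ∑ j ∈ S, Real.exp (μ j) with hW
  set W' := ∑ j ∈ S, Real.exp (μ' j) with hW'
  have hWpos : 0 < W := sum_exp_pos μ hS
  have hWpos' : 0 < W' := sum_exp_pos μ' hS
  set p := ∑ a : S, choiceProb μ S a * reportCost x S a with hp
  have hlog : ∀ a : S, Real.log (choiceProb μ' S a / choiceProb μ S a) =
      d * reportCost x S a - Real.log (W' / W) := by
    intro a
    have he : choiceProb μ' S a / choiceProb μ S a = Real.exp (μ' a - μ a) / (W' / W) := by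
      rw [Real.exp_sub]
      simp only [choiceProb, ← hW, ← hW']
      have := Real.exp_pos (μ a)
      field_simp
    rw [he, Real.log_div (Real.exp_pos _).ne' (div_pos hWpos' hWpos).ne', Real.log_exp]
    congr 1
    unfold reportCost
    split_ifs with hax
    · rw [← hax, mul_one]
    · rw [h a (Ne.symm hax), sub_self, mul_zero]
  -- Only the weight of `x` changes, and `p` is its share of `W` if `x ∈ S`, and 0 otherwise.
  have hratio : W' / W - 1 = (Real.exp d - 1) * p := by
    have h1 : W' - W = (Real.exp d - 1) * (W * p) := by
      rw [hp, Finset.mul_sum, Finset.mul_sum, hW', hW, ← Finset.sum_sub_distrib,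
        ← Finset.sum_coe_sort S]
      refine Finset.sum_congr rfl fun a _ => ?_
      have hc : W * choiceProb μ S a = Real.exp (μ a) := by
        simp only [choiceProb, ← hW]
        field_simp
      rw [← hW, ← mul_assoc W, hc]
      unfold reportCost
      split_ifs with hax
      · rw [← hax, hd, Real.exp_sub]
        have := Real.exp_pos (μ x)
        field_simp
      · rw [h a (Ne.symm hax)]
        ring
    rw [div_sub_one hWpos.ne', h1]
    field_simp
  have hle := Real.log_le_sub_one_of_pos (div_pos hWpos' hWpos)
  have hsum : ∑ a : S, choiceProb μ S a * Real.log (choiceProb μ' S a / choiceProb μ S a) =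
      d * p - Real.log (W' / W) := by
    simp only [hlog, mul_sub]
    rw [Finset.sum_sub_distrib, ← Finset.sum_mul, sum_choiceProb μ hS, one_mul, hp,
      Finset.mul_sum]
    congr 1
    exact Finset.sum_congr rfl fun a _ => by ring
  rw [hsum]
  rw [hratio] at hle
  linarith

/-- The Donsker-Varadhan inequality for the output of an algorithm, when the score of one label
changes. -/
lemma exp_outputProb_sub_reportCost_le {μ μ' : Fin n → ℝ} {x : Fin n}
    (h : ∀ y, y ≠ x → μ' y = μ y) (s : ℝ) (R : Finset (Fin n)) (t : DetAlgorithm n l) :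
    Real.exp (s * t.outputProb μ R -
        (Real.exp (μ' x - μ x) - 1 - (μ' x - μ x)) * t.expectedCost μ (reportCost x)) ≤
      1 + (Real.exp s - 1) * t.outputProb μ' R := by
  set D := Real.exp (μ' x - μ x) - 1 - (μ' x - μ x) with hD
  induction t with
  | output R' =>
    simp only [expectedCost, outputProb, outputLaw, PMF.pure_apply]
    split_ifs <;> simp
  | compare S h₁ h₂ next ih =>
    have hS := nonempty_of_two_le h₁
    set u : S → ℝ := fun a => s * (next a).outputProb μ R -
      D * (next a).expectedCost μ (reportCost x) with hu
    -- Jensen under the law of `μ`; the log-likelihood ratio in the exponent turns the average of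
    -- exponentials into one under `μ'`, to which induction applies.
    have hJ := convexOn_exp.map_sum_le (t := (Finset.univ : Finset S))
      (w := fun a => choiceProb μ S a)
      (p := fun a => u a + Real.log (choiceProb μ' S a / choiceProb μ S a))
      (fun a _ => choiceProb_nonneg μ S a) (sum_choiceProb μ hS) (fun a _ => Set.mem_univ _)
    simp only [smul_eq_mul] at hJ
    have hterm : ∀ a : S, choiceProb μ S a *
        Real.exp (u a + Real.log (choiceProb μ' S a / choiceProb μ S a)) =
          choiceProb μ' S a * Real.exp (u a) := by
      intro a
      have h0 := choiceProb_pos μ hS a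
      rw [Real.exp_add, Real.exp_log (div_pos (choiceProb_pos μ' hS a) h0)]
      field_simp
    simp only [hterm] at hJ
    have hright : ∑ a : S, choiceProb μ' S a * Real.exp (u a) ≤
        1 + (Real.exp s - 1) * (compare S h₁ h₂ next).outputProb μ' R := by
      have h1 : 1 + (Real.exp s - 1) * (compare S h₁ h₂ next).outputProb μ' R =
          ∑ a : S, choiceProb μ' S a * (1 + (Real.exp s - 1) * (next a).outputProb μ' R) := by
        rw [outputProb_compare, Finset.mul_sum]
        nth_rewrite 1 [← sum_choiceProb μ' hS]
        rw [← Finset.sum_add_distrib]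
        exact Finset.sum_congr rfl fun a _ => by ring
      rw [h1]
      exact Finset.sum_le_sum fun a _ =>
        mul_le_mul_of_nonneg_left (ih a) (choiceProb_nonneg _ _ _)
    refine le_trans (Real.exp_le_exp.mpr ?_) (hJ.trans hright)
    have hkl := neg_sum_le_sum_choiceProb_mul_log h hS
    rw [← hD] at hkl
    have hleft : s * (compare S h₁ h₂ next).outputProb μ R -
        D * (compare S h₁ h₂ next).expectedCost μ (reportCost x) =
          ∑ a : S, choiceProb μ S a * u a -
            D * ∑ a : S, choiceProb μ S a * reportCost x S a := by
      rw [outputProb_compare, expectedCost, Finset.mul_sum, Finset.mul_sum, Finset.mul_sum,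
        ← Finset.sum_sub_distrib, ← Finset.sum_sub_distrib]
      exact Finset.sum_congr rfl fun a _ => by rw [hu]; ring
    rw [hleft]
    simp only [mul_add, Finset.sum_add_distrib]
    linarith

end DetAlgorithm

/-! ### Levelling two items across the boundary -/

/-- The score of each label, when item `i` has score `μ i` and label `π i`. -/
def labelScore {n : ℕ} (μ : Fin n → ℝ) (π : Equiv.Perm (Fin n)) (j : Fin n) : ℝ := μ (π.symm j)

/-- The scores of the labels after the score of item `i` is replaced by that of item `j`. -/
def levelledScore {n : ℕ} (μ : Fin n → ℝ) (i j : Fin n) (π : Equiv.Perm (Fin n)) : Fin n → ℝ :=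
  Function.update (labelScore μ π) (π i) (μ j)

lemma levelledScore_of_ne {n : ℕ} (μ : Fin n → ℝ) (i j : Fin n) (π : Equiv.Perm (Fin n))
    (y : Fin n) (hy : y ≠ π i) : levelledScore μ i j π y = labelScore μ π y :=
  Function.update_of_ne hy _ _

lemma levelledScore_self {n : ℕ} (μ : Fin n → ℝ) (i j : Fin n) (π : Equiv.Perm (Fin n)) :
    levelledScore μ i j π (π i) = μ j :=
  Function.update_self _ _ _

lemma labelScore_apply {n : ℕ} (μ : Fin n → ℝ) (i : Fin n) (π : Equiv.Perm (Fin n)) :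
    labelScore μ π (π i) = μ i := by
  simp [labelScore]

/-- Once items `i` and `j` have the same score, exchanging their labels changes nothing. -/
lemma levelledScore_mul_swap {n : ℕ} (μ : Fin n → ℝ) (i j : Fin n) (π : Equiv.Perm (Fin n)) :
    levelledScore μ i j (π * Equiv.swap i j) = levelledScore μ i j π := by
  funext y
  obtain ⟨z, rfl⟩ := π.surjective y
  have hsymm : (π * Equiv.swap i j).symm (π z) = Equiv.swap i j z := by
    rw [Equiv.symm_apply_eq]
    simp
  simp only [levelledScore, Function.update_apply, labelScore, hsymm, Equiv.Perm.mul_apply,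
    Equiv.swap_apply_left, Equiv.symm_apply_apply, π.injective.eq_iff]
  by_cases hi : z = i
  · subst hi
    simp
  · by_cases hj : z = j
    · subst hj
      simp
    · rw [if_neg hi, if_neg hj, Equiv.swap_apply_of_ne_of_ne hi hj]

lemma mem_topLabels {n k : ℕ} (π : Equiv.Perm (Fin n)) (i : Fin n) :
    π i ∈ topLabels k π ↔ i.val < k := by
  simp [topLabels]

lemma topLabels_ne_mul_swap {n k : ℕ} {i j : Fin n} (h : ¬(i.val < k ↔ j.val < k))
    (π : Equiv.Perm (Fin n)) : topLabels k π ≠ topLabels k (π * Equiv.swap i j) := by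
  intro heq
  have h1 := mem_topLabels (k := k) (π * Equiv.swap i j) i
  rw [← heq, Equiv.Perm.mul_apply, Equiv.swap_apply_left, mem_topLabels] at h1
  exact h h1.symm

/-- Pairing `π` with `π * swap i j` gives the same scores but two different correct sets, whose
output probabilities sum to at most 1. -/
lemma sum_outputProb_levelledScore_le {n k l : ℕ} (t : DetAlgorithm n l) (μ : Fin n → ℝ)
    {i j : Fin n} (h : ¬(i.val < k ↔ j.val < k)) :
    ∑ π : Equiv.Perm (Fin n), t.outputProb (levelledScore μ i j π) (topLabels k π) ≤
      Fintype.card (Equiv.Perm (Fin n)) / 2 := by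
  have hswap : ∑ π : Equiv.Perm (Fin n),
      t.outputProb (levelledScore μ i j π) (topLabels k (π * Equiv.swap i j)) =
        ∑ π : Equiv.Perm (Fin n), t.outputProb (levelledScore μ i j π) (topLabels k π) := by
    rw [← Equiv.sum_comp (Equiv.mulRight (Equiv.swap i j))
      (fun π => t.outputProb (levelledScore μ i j π) (topLabels k π))]
    exact Finset.sum_congr rfl fun π _ => by
      rw [Equiv.coe_mulRight, levelledScore_mul_swap]
  have hle : ∑ π : Equiv.Perm (Fin n), (t.outputProb (levelledScore μ i j π) (topLabels k π) +
      t.outputProb (levelledScore μ i j π) (topLabels k (π * Equiv.swap i j))) ≤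
        ∑ _π : Equiv.Perm (Fin n), (1 : ℝ) :=
    Finset.sum_le_sum fun π _ =>
      DetAlgorithm.outputProb_add_le_one _ (topLabels_ne_mul_swap h π) t
  rw [Finset.sum_add_distrib, hswap, Finset.sum_const, Finset.card_univ, nsmul_one] at hle
  linarith

/-! ### Lower bounds on the average cost of one item -/

/-- The expected cost for item `i`, averaged over all labellings. -/
noncomputable def averageCost {n l : ℕ} (t : DetAlgorithm n l) (μ : Fin n → ℝ)
    (c : Fin n → Finset (Fin n) → Fin n → ℝ) (i : Fin n) : ℝ :=
  (∑ π : Equiv.Perm (Fin n), t.expectedCost (labelScore μ π) (c (π i))) /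
    Fintype.card (Equiv.Perm (Fin n))

section

variable {n l : ℕ} (t : DetAlgorithm n l) (μ : Fin n → ℝ)

lemma card_perm_pos : (0 : ℝ) < Fintype.card (Equiv.Perm (Fin n)) :=
  Nat.cast_pos.mpr Fintype.card_pos

lemma sum_averageCost_le {c : Fin n → Finset (Fin n) → Fin n → ℝ} {B : ℝ}
    (h : ∀ π : Equiv.Perm (Fin n),
      ∑ i, t.expectedCost (labelScore μ π) (c (π i)) ≤ B) :
    ∑ i, averageCost t μ c i ≤ B := by
  unfold averageCost
  rw [← Finset.sum_div, div_le_iff₀ card_perm_pos, Finset.sum_comm]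
  refine (Finset.sum_le_sum fun π _ => h π).trans_eq ?_
  rw [Finset.sum_const, Finset.card_univ, nsmul_eq_mul, mul_comm]

lemma averageCost_reportCost_nonneg (i : Fin n) :
    0 ≤ averageCost t μ DetAlgorithm.reportCost i :=
  div_nonneg (Finset.sum_nonneg fun _ _ =>
    DetAlgorithm.expectedCost_nonneg _ (DetAlgorithm.reportCost_nonneg _) _) card_perm_pos.le

variable {t μ} {k : ℕ}

/-- The cost must cover the drop in success, at least 7/8 - 1/2 = 3/8. -/
lemma le_averageCost_of_outputProb_sub_le
    (hsucc : 7 / 8 * (Fintype.card (Equiv.Perm (Fin n)) : ℝ) ≤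
      ∑ π : Equiv.Perm (Fin n), t.outputProb (labelScore μ π) (topLabels k π))
    {i j : Fin n} (h : ¬(i.val < k ↔ j.val < k)) {c : Fin n → Finset (Fin n) → Fin n → ℝ}
    (hc : ∀ π : Equiv.Perm (Fin n), t.outputProb (labelScore μ π) (topLabels k π) -
      t.expectedCost (labelScore μ π) (c (π i)) ≤
        t.outputProb (levelledScore μ i j π) (topLabels k π)) :
    3 / 8 ≤ averageCost t μ c i := by
  unfold averageCost
  rw [le_div_iff₀ card_perm_pos]
  have h1 := sum_outputProb_levelledScore_le t μ h
  have h2 := Finset.sum_le_sum fun (π : Equiv.Perm (Fin n)) (_ : π ∈ Finset.univ) => hc π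
  rw [Finset.sum_sub_distrib] at h2
  linarith

lemma le_averageCost_touchCost
    (hsucc : 7 / 8 * (Fintype.card (Equiv.Perm (Fin n)) : ℝ) ≤
      ∑ π : Equiv.Perm (Fin n), t.outputProb (labelScore μ π) (topLabels k π))
    {i j : Fin n} (h : ¬(i.val < k ↔ j.val < k)) :
    3 / 8 ≤ averageCost t μ DetAlgorithm.touchCost i :=
  le_averageCost_of_outputProb_sub_le hsucc h fun π =>
    DetAlgorithm.outputProb_sub_touchCost_le (levelledScore_of_ne μ i j π) _ t

lemma le_averageCost_reportCost
    (hsucc : 7 / 8 * (Fintype.card (Equiv.Perm (Fin n)) : ℝ) ≤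
      ∑ π : Equiv.Perm (Fin n), t.outputProb (labelScore μ π) (topLabels k π))
    {i j : Fin n} (h : ¬(i.val < k ↔ j.val < k)) (hij : μ j ≤ μ i) :
    3 / 8 ≤ averageCost t μ DetAlgorithm.reportCost i :=
  le_averageCost_of_outputProb_sub_le hsucc h fun π =>
    DetAlgorithm.outputProb_sub_reportCost_le (levelledScore_of_ne μ i j π)
      (by rwa [levelledScore_self, labelScore_apply]) _ t

/-- The entropy inequality with parameter 1/4 leaves at least 1/4 * 7/8 - 5/16 * 1/2 = 1/16. -/
lemma le_mul_averageCost_reportCost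
    (hsucc : 7 / 8 * (Fintype.card (Equiv.Perm (Fin n)) : ℝ) ≤
      ∑ π : Equiv.Perm (Fin n), t.outputProb (labelScore μ π) (topLabels k π))
    {i j : Fin n} (h : ¬(i.val < k ↔ j.val < k)) :
    1 / 16 ≤ (Real.exp (μ j - μ i) - 1 - (μ j - μ i)) *
      averageCost t μ DetAlgorithm.reportCost i := by
  set D := Real.exp (μ j - μ i) - 1 - (μ j - μ i) with hD
  unfold averageCost
  rw [mul_div_assoc', le_div_iff₀ card_perm_pos]
  have h1 := sum_outputProb_levelledScore_le t μ h
  have hexp : Real.exp (1 / 4) - 1 ≤ 5 / 16 := by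
    have h4 : Real.exp (1 / 4) ^ 4 = Real.exp 1 := by
      rw [← Real.exp_nat_mul]
      norm_num
    have := Real.exp_one_lt_d9
    have : Real.exp (1 / 4) ≤ 21 / 16 := by
      refine le_of_pow_le_pow_left₀ (n := 4) (by norm_num) (by norm_num) ?_
      rw [h4]
      norm_num
      linarith
    linarith
  have h2 : ∀ π : Equiv.Perm (Fin n),
      1 / 4 * t.outputProb (labelScore μ π) (topLabels k π) -
        D * t.expectedCost (labelScore μ π) (DetAlgorithm.reportCost (π i)) ≤
          5 / 16 * t.outputProb (levelledScore μ i j π) (topLabels k π) := by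
    intro π
    have hdv := DetAlgorithm.exp_outputProb_sub_reportCost_le (levelledScore_of_ne μ i j π)
      (1 / 4) (topLabels k π) t
    rw [levelledScore_self, labelScore_apply, ← hD] at hdv
    -- Replacing the exponential by `1 + x` makes the inequality linear, so it can be summed over
    -- labellings.
    have hlin := (Real.add_one_le_exp _).trans hdv
    have := mul_le_mul_of_nonneg_right hexp
      (DetAlgorithm.outputProb_nonneg (levelledScore μ i j π) (topLabels k π) t)
    linarith
  have h3 := Finset.sum_le_sum fun (π : Equiv.Perm (Fin n)) (_ : π ∈ Finset.univ) => h2 π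
  rw [Finset.sum_sub_distrib, ← Finset.mul_sum, ← Finset.mul_sum, ← Finset.mul_sum] at h3
  linarith

end

/-! ### Reduction to deterministic algorithms -/

lemma successProb_eq_tsum {n l : ℕ} (A : Algorithm n l) (μ : Fin n → ℝ) (k : ℕ) :
    successProb A μ k = ∑' t, A t * (∑ π : Equiv.Perm (Fin n),
      (Fintype.card (Equiv.Perm (Fin n)) : ℝ≥0∞)⁻¹ *
        t.outputLaw (labelScore μ π) (topLabels k π)) := by
  unfold successProb jointLaw
  simp only [PMF.toOuterMeasure_bind_apply, PMF.toOuterMeasure_map_apply,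
    PMF.uniformOfFintype_apply]
  have hpre : ∀ π : Equiv.Perm (Fin n), (fun R : Finset (Fin n) => (π, R)) ⁻¹'
      {x : Equiv.Perm (Fin n) × Finset (Fin n) | x.2 = topLabels k x.1} = {topLabels k π} :=
    fun π => rfl
  simp only [hpre, PMF.toOuterMeasure_apply_singleton, Finset.mul_sum, ← ENNReal.tsum_mul_left]
  rw [ENNReal.tsum_comm]
  refine tsum_congr fun t => ?_
  rw [tsum_fintype]
  exact Finset.sum_congr rfl fun π _ => mul_left_comm _ _ _

/-- Some deterministic algorithm among those that `A` randomizes over is at least as successful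
as `A`. -/
lemma exists_mem_support_le_sum_outputProb {n k l : ℕ} {A : Algorithm n l} {μ : Fin n → ℝ}
    (hA : 7 / 8 ≤ successProb A μ k) :
    ∃ t ∈ A.support, 7 / 8 * (Fintype.card (Equiv.Perm (Fin n)) : ℝ) ≤
      ∑ π : Equiv.Perm (Fin n), t.outputProb (labelScore μ π) (topLabels k π) := by
  by_contra! hcon
  set s : DetAlgorithm n l → ℝ≥0∞ := fun t => ∑ π : Equiv.Perm (Fin n),
    (Fintype.card (Equiv.Perm (Fin n)) : ℝ≥0∞)⁻¹ *
      t.outputLaw (labelScore μ π) (topLabels k π) with hs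
  have hlt : ∀ t ∈ A.support, s t < 7 / 8 := by
    intro t ht
    have hfin : ∀ π ∈ (Finset.univ : Finset (Equiv.Perm (Fin n))),
        t.outputLaw (labelScore μ π) (topLabels k π) ≠ ∞ := fun π _ => PMF.apply_ne_top _ _
    have hc := hcon t ht
    simp only [DetAlgorithm.outputProb] at hc
    rw [← ENNReal.toReal_sum hfin] at hc
    have hst : s t = (Fintype.card (Equiv.Perm (Fin n)) : ℝ≥0∞)⁻¹ *
        ∑ π : Equiv.Perm (Fin n), t.outputLaw (labelScore μ π) (topLabels k π) := by
      rw [hs, Finset.mul_sum]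
    have hcard : (Fintype.card (Equiv.Perm (Fin n)) : ℝ≥0∞) ≠ 0 :=
      Nat.cast_ne_zero.mpr Fintype.card_ne_zero
    have hne : s t ≠ ∞ := by
      rw [hst]
      exact ENNReal.mul_ne_top (ENNReal.inv_ne_top.mpr hcard) (ENNReal.sum_ne_top.mpr hfin)
    rw [← ENNReal.toReal_lt_toReal hne (by finiteness), hst, ENNReal.toReal_mul,
      ENNReal.toReal_inv, ENNReal.toReal_natCast, ENNReal.toReal_div,
      inv_mul_lt_iff₀ card_perm_pos]
    norm_num
    linarith
  obtain ⟨t₀, ht₀⟩ := A.support_nonempty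
  have htsum : ∑' t, A t * (7 / 8 : ℝ≥0∞) = 7 / 8 := by
    rw [ENNReal.tsum_mul_right, A.tsum_coe, one_mul]
  have hle : ∀ t, A t * s t ≤ A t * (7 / 8 : ℝ≥0∞) := fun t => by
    by_cases ht : t ∈ A.support
    · exact mul_le_mul_right (hlt t ht).le _
    · rw [(A.apply_eq_zero_iff t).mpr ht, zero_mul, zero_mul]
  have hstrict : ∑' t, A t * s t < ∑' t, A t * (7 / 8 : ℝ≥0∞) := by
    refine ENNReal.tsum_lt_tsum (i := t₀) ?_ hle ?_
    · refine ne_top_of_le_ne_top ?_ (ENNReal.tsum_le_tsum hle)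
      rw [htsum]
      finiteness
    · exact ENNReal.mul_lt_mul_right ((A.mem_support_iff t₀).mp ht₀) (A.apply_ne_top t₀)
        (hlt t₀ ht₀)
  rw [htsum, ← successProb_eq_tsum] at hstrict
  exact absurd hA hstrict.not_ge

/-! ### Entropy bounds in terms of the weights `exp (μ i)` -/

lemma exp_sub_one_sub_le (x : ℝ) : Real.exp x - 1 - x ≤ (Real.exp x - 1) ^ 2 / Real.exp x := by
  have h := Real.add_one_le_exp (-x)
  have hpos := Real.exp_pos x
  rw [Real.exp_neg] at h
  have : (Real.exp x - 1) ^ 2 / Real.exp x = Real.exp x - 2 + (Real.exp x)⁻¹ := by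
    field_simp
    ring
  linarith

/-- The quadratic bound on `exp d - 1 - d` is effective for close scores and holds for either sign
of `d`, so it serves items on both sides of the boundary. -/
lemma mul_div_sq_sub_le_averageCost {n k l : ℕ} {t : DetAlgorithm n l} {μ : Fin n → ℝ}
    (hsucc : 7 / 8 * (Fintype.card (Equiv.Perm (Fin n)) : ℝ) ≤
      ∑ π : Equiv.Perm (Fin n), t.outputProb (labelScore μ π) (topLabels k π))
    {i j : Fin n} (h : ¬(i.val < k ↔ j.val < k)) (hij : μ i ≠ μ j) :
    Real.exp (μ j) * Real.exp (μ i) / (Real.exp (μ j) - Real.exp (μ i)) ^ 2 ≤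
      16 * averageCost t μ DetAlgorithm.reportCost i := by
  have h1 := (le_mul_averageCost_reportCost hsucc h).trans
    (mul_le_mul_of_nonneg_right (exp_sub_one_sub_le (μ j - μ i))
      (averageCost_reportCost_nonneg t μ i))
  have hi := Real.exp_pos (μ i)
  have hj := Real.exp_pos (μ j)
  have hne : Real.exp (μ j) - Real.exp (μ i) ≠ 0 :=
    sub_ne_zero.mpr fun he => hij (Real.exp_injective he).symm
  have hsq : 0 < (Real.exp (μ j) - Real.exp (μ i)) ^ 2 := by positivity
  have hr : (Real.exp (μ j - μ i) - 1) ^ 2 / Real.exp (μ j - μ i) =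
      (Real.exp (μ j) - Real.exp (μ i)) ^ 2 / (Real.exp (μ j) * Real.exp (μ i)) := by
    rw [Real.exp_sub]
    field_simp
  rw [hr, div_mul_eq_mul_div, le_div_iff₀ (mul_pos hj hi)] at h1
  rw [div_le_iff₀ hsq]
  linarith

/-- For `d ≥ 0` the cruder bound `exp d - 1 - d ≤ exp d` suffices, however far apart the scores are.
-/
lemma exp_div_exp_le_averageCost {n k l : ℕ} {t : DetAlgorithm n l} {μ : Fin n → ℝ}
    (hsucc : 7 / 8 * (Fintype.card (Equiv.Perm (Fin n)) : ℝ) ≤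
      ∑ π : Equiv.Perm (Fin n), t.outputProb (labelScore μ π) (topLabels k π))
    {i j : Fin n} (h : ¬(i.val < k ↔ j.val < k)) (hij : μ i ≤ μ j) :
    Real.exp (μ i) / Real.exp (μ j) ≤ 16 * averageCost t μ DetAlgorithm.reportCost i := by
  have h1 := (le_mul_averageCost_reportCost hsucc h).trans
    (mul_le_mul_of_nonneg_right (by linarith : _ ≤ Real.exp (μ j - μ i))
      (averageCost_reportCost_nonneg t μ i))
  have hi := Real.exp_pos (μ i)
  rw [Real.exp_sub, div_mul_eq_mul_div, le_div_iff₀ hi] at h1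
  rw [div_le_iff₀ (Real.exp_pos _)]
  linarith

end TopK

/-! ### The lower bound -/

/-- Items are numbered from `0`: item `k` of the usual numbering is `⟨k - 1, _⟩ : Fin n`, item
`k + 1` is `⟨k, _⟩`, and the top-`k` items are those with `i.val < k`. The algorithm `A` is
quantified after the scores, so it may depend on all of their values; only the labelling is hidden
from it. -/
theorem theorem2 :
    ∃ c : ℝ, 0 < c ∧
      ∀ (n k l : ℕ) (hk : 1 ≤ k) (hkn : k < n) (_hl : 2 ≤ l)
        (μ θ : Fin n → ℝ) (_hθ : ∀ i, θ i = Real.exp (μ i)) (_hμ : Antitone μ)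
        (θk θk1 : ℝ) (_hθk : θk = θ ⟨k - 1, by omega⟩) (_hθk1 : θk1 = θ ⟨k, hkn⟩)
        (_hgap : μ ⟨k, hkn⟩ < μ ⟨k - 1, by omega⟩)
        (A : TopK.Algorithm n l) (T : ℕ),
        A.UsesAtMost T →
        7 / 8 ≤ TopK.successProb A μ k →
        c * ((n : ℝ) / l + k
            + (∑ i : Fin n with k ≤ i.val, θ i) / θk
            + ∑ i : Fin n with k ≤ i.val ∧ θk / 2 ≤ θ i, θk ^ 2 / (θk - θ i) ^ 2
            + ∑ i : Fin n with i.val < k ∧ θ i ≤ 2 * θk1, θk1 ^ 2 / (θk1 - θ i) ^ 2) ≤ T := by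
  -- The five terms are at most 8/3, 8/3, 16, 32 and 16 times `T`, in total less than `100 * T`.
  refine ⟨1 / 100, by norm_num, ?_⟩
  intro n k l hk hkn hl μ θ hθ hμ θk θk1 hθk hθk1 hgap A T hT hA
  obtain ⟨t, ht, hsucc⟩ := TopK.exists_mem_support_le_sum_outputProb hA
  have htT : (t.comparisons : ℝ) ≤ T := Nat.cast_le.mpr (hT t ht)
  set N := TopK.averageCost t μ TopK.DetAlgorithm.reportCost with hN
  have hN0 : ∀ i, 0 ≤ N i := TopK.averageCost_reportCost_nonneg t μ
  have hNsum : ∑ i, N i ≤ T :=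
    (TopK.sum_averageCost_le t μ fun π => TopK.DetAlgorithm.sum_reportCost_le π t).trans htT
  have hNle : ∀ s : Finset (Fin n), ∑ i ∈ s, N i ≤ T := fun s =>
    (Finset.sum_le_univ_sum_of_nonneg hN0).trans hNsum
  set a : Fin n := ⟨k - 1, by omega⟩ with ha
  set b : Fin n := ⟨k, hkn⟩ with hb
  have hak : a.val < k := by simp only [ha]; omega
  have hbk : ¬ b.val < k := by simp [hb]
  have hlow : ∀ i : Fin n, k ≤ i.val → ¬(i.val < k ↔ a.val < k) := fun i hi => by simp [hi, hak]
  have htop : ∀ i : Fin n, i.val < k → ¬(i.val < k ↔ b.val < k) := fun i hi => by simp [hi, hbk]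
  have hμa : ∀ i : Fin n, k ≤ i.val → μ i < μ a := fun i hi =>
    lt_of_le_of_lt (hμ (Fin.le_def.mpr hi)) hgap
  have hμb : ∀ i : Fin n, i.val < k → μ b < μ i := fun i hi =>
    lt_of_lt_of_le hgap (hμ (Fin.le_def.mpr (by simp only [ha]; omega)))
  have h1 : (n : ℝ) / l ≤ 8 / 3 * T := by
    have hM : ∑ i, TopK.averageCost t μ TopK.DetAlgorithm.touchCost i ≤ l * t.comparisons :=
      TopK.sum_averageCost_le t μ fun π => TopK.DetAlgorithm.sum_touchCost_le π t
    have hge : ∑ _i : Fin n, (3 / 8 : ℝ) ≤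
        ∑ i, TopK.averageCost t μ TopK.DetAlgorithm.touchCost i := by
      refine Finset.sum_le_sum fun i _ => ?_
      by_cases hi : i.val < k
      · exact TopK.le_averageCost_touchCost hsucc (htop i hi)
      · exact TopK.le_averageCost_touchCost hsucc (hlow i (not_lt.mp hi))
    have hl0 : (0 : ℝ) < l := Nat.cast_pos.mpr (by omega)
    have := mul_le_mul_of_nonneg_left htT hl0.le
    rw [Finset.sum_const, Finset.card_univ, Fintype.card_fin, nsmul_eq_mul] at hge
    rw [div_le_iff₀ hl0]
    linarith
  have h2 : (k : ℝ) ≤ 8 / 3 * T := by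
    have hge : ∑ _i : Fin n with _i.val < k, (3 / 8 : ℝ) ≤ ∑ i : Fin n with i.val < k, N i := by
      refine Finset.sum_le_sum fun i hi => ?_
      have hi' := (Finset.mem_filter.mp hi).2
      exact TopK.le_averageCost_reportCost hsucc (htop i hi') (hμb i hi').le
    rw [Finset.sum_const, Fin.card_filter_val_lt, min_eq_right hkn.le, nsmul_eq_mul] at hge
    have := hNle {i | i.val < k}
    linarith
  have h3 : (∑ i : Fin n with k ≤ i.val, θ i) / θk ≤ 16 * T := by
    refine le_trans ?_ (mul_le_mul_of_nonneg_left (hNle {i | k ≤ i.val}) (by norm_num))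
    rw [Finset.sum_div, Finset.mul_sum]
    refine Finset.sum_le_sum fun i hi => ?_
    have hi' := (Finset.mem_filter.mp hi).2
    rw [hθk, hθ, hθ]
    exact TopK.exp_div_exp_le_averageCost hsucc (hlow i hi') (hμa i hi').le
  have h4 : ∑ i : Fin n with k ≤ i.val ∧ θk / 2 ≤ θ i, θk ^ 2 / (θk - θ i) ^ 2 ≤ 32 * T := by
    refine le_trans ?_ (mul_le_mul_of_nonneg_left
      (hNle {i | k ≤ i.val ∧ θk / 2 ≤ θ i}) (by norm_num))
    rw [Finset.mul_sum]
    refine Finset.sum_le_sum fun i hi => ?_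
    obtain ⟨hi', hi2⟩ := (Finset.mem_filter.mp hi).2
    have hgapi := TopK.mul_div_sq_sub_le_averageCost hsucc (hlow i hi') (hμa i hi').ne
    rw [← hθ, ← hθ, ← hθk] at hgapi
    have hpos : 0 < θk := by rw [hθk, hθ]; exact Real.exp_pos _
    -- The restriction `θk / 2 ≤ θ i` gives `θk ^ 2 ≤ 2 * (θk * θ i)`, at the price of a factor 2.
    calc θk ^ 2 / (θk - θ i) ^ 2 ≤ 2 * (θk * θ i) / (θk - θ i) ^ 2 :=
          div_le_div_of_nonneg_right (by nlinarith) (sq_nonneg _)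
      _ = 2 * (θk * θ i / (θk - θ i) ^ 2) := mul_div_assoc _ _ _
      _ ≤ 32 * N i := by linarith
  have h5 : ∑ i : Fin n with i.val < k ∧ θ i ≤ 2 * θk1, θk1 ^ 2 / (θk1 - θ i) ^ 2 ≤ 16 * T := by
    refine le_trans ?_ (mul_le_mul_of_nonneg_left
      (hNle {i | i.val < k ∧ θ i ≤ 2 * θk1}) (by norm_num))
    rw [Finset.mul_sum]
    refine Finset.sum_le_sum fun i hi => ?_
    have hi' := (Finset.mem_filter.mp hi).2.1
    have hgapi := TopK.mul_div_sq_sub_le_averageCost hsucc (htop i hi') (hμb i hi').ne'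
    have hle : θk1 ≤ θ i := by
      rw [hθk1, hθ, hθ]
      exact Real.exp_le_exp.mpr (hμb i hi').le
    rw [← hθ, ← hθ, ← hθk1] at hgapi
    have hpos : 0 < θk1 := by rw [hθk1, hθ]; exact Real.exp_pos _
    -- Here `θk1 ≤ θ i` already gives `θk1 ^ 2 ≤ θk1 * θ i`, with no loss.
    exact (div_le_div_of_nonneg_right (by nlinarith) (sq_nonneg _)).trans hgapi
  have hT0 : (0 : ℝ) ≤ T := Nat.cast_nonneg T
  linarith
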